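/- **Setting.** Let $\Sigma_3=\{0,1,2\}^{\mathbb Z}$ with the product topology and the shift $\sigma$. Let $\Phi$ be a $C^1$ diffeomorphism of $\mathbb R^2$, let $\widehat C_0,\widehat C_1,\widehat C_2\subset[0,1]^2$ be pairwise disjoint, and let $\Gamma$ be the maximal $\Phi$-invariant set in $\widehat C_0\cup\widehat C_1\cup\widehat C_2$, i.e. the set of points whose full $\Phi$-orbit stays in this union. Assume that there is a homeomorphism $\varpi\colon\Gamma\to\Sigma_3$ with $\varpi\circ\Phi=\sigma\circ\varpi$ and such that, for $\theta\in\Gamma$, $\theta\in\widehat C_i$ if and only if $\varpi(\theta)_0=i$. Let $f_0,f_1,f_2\colon[0,1]\to[0,1]$ be injective $C^1$ maps with nowhere vanishing derivative (one-sided at the end points) such that * $f_0$ is increasing, its fixed points are exactly $0$ and $1$, $f_0'(0)>1$, $\lambda_0:=f_0'(1)\in(0,1)$, and $f_0'\ge\lambda_0$ on $[0,1]$; * $f_1(x)=\gamma(1-x)$ with $\lambda_0\le\gamma<1$; * $f_2$ is increasing, its fixed points are exactly $0$ and some $p_2\in(0,1)$, $f_2'(0)>1$, and $|f_2'(p_2)|<1$.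 Let $F(\hat x,x)=(\Phi(\hat x),f_i(x))$ for $\hat x\in\widehat C_i$, $x\in[0,1]$, and let $\Lambda\subset\Gamma\times[0,1]$ be the maximal $F$-invariant set in $\bigcup_i\widehat C_i\times[0,1]$. Put $\pi\colon\Lambda\to\Sigma_3$, $\pi(\hat x,x)=\varpi(\hat x)$, and let $\Lambda_{02}=\varpi^{-1}(\{0,2\}^{\mathbb Z})\times\{0\}$ be the lateral horseshoe. For an $F$-invariant Borel probability measure $\mu$ on $\Lambda$ let $h_\mu(F)$ be its Kolmogorov–Sinai entropy and let $$\chi(\mu)=\int_\Lambda \log|f_i'(x)|\,d\mu(\hat x,x)\qquad(\hat x\in\widehat C_i)$$ be its central Lyapunov exponent. **Proposition.** There are ergodic $F$-invariant Borel probability measures $\mu_1,\mu_2$ on $\Lambda$ such that $$h_{\mu_1}(F)=h_{\mu_2}(F)=\log 2,\qquad \chi(\mu_1)\le 0<\chi(\mu_2)$$ (the integrals defining $\chi(\mu_1)$ and $\chi(\mu_2)$ being absolutely convergent). Moreover $\pi_*\mu_1=\pi_*\mu_2$ is the $(\tfrac12,0,\tfrac12)$-Bernoulli measure on $\Sigma_3$,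 and $\mu_2$ is supported on $\Lambda_{02}$, i.e. $\mu_2(\Lambda\setminus\Lambda_{02})=0$. -/

import Mathlib

open MeasureTheory Set Filter Topology

noncomputable section

namespace HorseshoeSkew

/-! ### Symbolic dynamics -/

/-- The space `{0,1,2}^ℤ` of bi-infinite sequences, with the product topology and the
product (= Borel) sigma-algebra. -/
abbrev Sigma3 : Type := ℤ → Fin 3

/-- The left shift. -/
def shift (ξ : Sigma3) : Sigma3 := fun n => ξ (n + 1)

/-- The `(p 0, p 1, p 2)`-Bernoulli measure on `{0,1,2}^ℤ`. -/
def bernoulliMeasure (p : PMF (Fin 3)) : Measure Sigma3 :=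
  Measure.infinitePi fun _ : ℤ => p.toMeasure

/-- The probability vector `(1/2, 0, 1/2)`. -/
def halfZeroHalf : PMF (Fin 3) :=
  PMF.ofFintype ![2⁻¹, 0, 2⁻¹] (by
    simp [Fin.sum_univ_three, ENNReal.inv_two_add_inv_two])

/-! ### Maximal invariant sets -/

/-- The maximal invariant set of `T` in `A`: the points that lie on a full orbit
`(u n)`, `n ∈ ℤ`, of `T` all of whose points belong to `A`. If `T` is injective on `A`, this is
`⋂ n ∈ ℤ, T ^ n (A)`, with `T` regarded as a partial map with domain `A`. -/
def maxInvariant {α : Type*} (T : α → α) (A : Set α) : Set α :=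
  {x | ∃ u : ℤ → α, u 0 = x ∧ ∀ n, u n ∈ A ∧ T (u n) = u (n + 1)}

theorem maxInvariant_mapsTo {α : Type*} (T : α → α) (A : Set α) :
    MapsTo T (maxInvariant T A) (maxInvariant T A) := by
  rintro x ⟨u, rfl, hu⟩
  refine ⟨fun n => u (n + 1), ?_, fun n => hu (n + 1)⟩
  simpa using (hu 0).2.symm

/-! ### Kolmogorov-Sinai entropy -/

section Entropy

variable {α : Type*} [MeasurableSpace α]

/-- The Shannon entropy `-∑ μ(A) log μ(A)` of the finite partition into the level sets of `Q`. -/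
def shannonEntropy {ι : Type*} [Fintype ι] (μ : Measure α) (Q : α → ι) : ℝ :=
  ∑ i, Real.negMulLog (μ.real (Q ⁻¹' {i}))

/-- The map whose level sets are the atoms of the join `⋁_{j < n} T^{-j} P`, where `P` stands for
the partition into the level sets of `P`. -/
def itinerary {k : ℕ} (T : α → α) (P : α → Fin k) (n : ℕ) : α → (Fin n → Fin k) :=
  fun x j => P (T^[j] x)

/-- The entropy of `T` with respect to `μ` and the partition `P`, as the upper limit of
`H_μ(⋁_{j < n} T^{-j} P) / n`; the limit exists when `μ` is invariant. -/
def partitionEntropy {k : ℕ} (μ : Measure α) (T : α → α) (P : α → Fin k) : EReal :=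
  limsup (fun n : ℕ => ((shannonEntropy μ (itinerary T P n) / n : ℝ) : EReal)) atTop

/-- The measure-theoretic (Kolmogorov-Sinai) entropy: the supremum of the entropies
over all finite measurable partitions. -/
def metricEntropy (μ : Measure α) (T : α → α) : EReal :=
  ⨆ (k : ℕ) (P : α → Fin k) (_ : Measurable P), partitionEntropy μ T P

end Entropy

/-! ### The class of skew products -/

/-- The derivative of an interval map `g : [0,1] → [0,1]`, one-sided at the end points. -/
def unitDeriv (g : ℝ → ℝ) (x : ℝ) : ℝ := derivWithin g (Icc 0 1) x

/-- Data of a skew product of three interval maps over a planar horseshoe with three legs. -/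
structure SkewProduct where
  /-- the base diffeomorphism of the plane -/
  Φ : (ℝ × ℝ) ≃ (ℝ × ℝ)
  contDiff_Φ : ContDiff ℝ 1 Φ
  contDiff_Φ_symm : ContDiff ℝ 1 Φ.symm
  /-- the three sub-cubes of the unit square over which the fibre maps are constant -/
  box : Fin 3 → Set (ℝ × ℝ)
  box_subset : ∀ i, box i ⊆ Icc 0 1 ×ˢ Icc 0 1
  box_disjoint : Pairwise fun i j => Disjoint (box i) (box j)
  /-- the conjugation between the horseshoe (the maximal invariant set of the base map in the
  union of the sub-cubes) and the full shift of three symbols -/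
  ϖ : maxInvariant Φ (⋃ i, box i) ≃ₜ Sigma3
  ϖ_conj : ∀ x y : maxInvariant Φ (⋃ i, box i), (y : ℝ × ℝ) = Φ x → ϖ y = shift (ϖ x)
  mem_box_iff : ∀ (x : maxInvariant Φ (⋃ i, box i)) (i : Fin 3),
    (x : ℝ × ℝ) ∈ box i ↔ ϖ x 0 = i
  /-- the fibre maps; only their values on `[0,1]` matter -/
  f : Fin 3 → ℝ → ℝ
  mapsTo_f : ∀ i, MapsTo (f i) (Icc 0 1) (Icc 0 1)
  injOn_f : ∀ i, InjOn (f i) (Icc 0 1)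
  contDiffOn_f : ∀ i, ContDiffOn ℝ 1 (f i) (Icc 0 1)
  /-- the fibre maps are diffeomorphisms onto their images -/
  unitDeriv_f_ne_zero : ∀ i, ∀ x ∈ Icc (0 : ℝ) 1, unitDeriv (f i) x ≠ 0
  /-- `f 0` is increasing, its fixed points are exactly `0` (repelling) and `1` (attracting), and
  its derivative is smallest at `1` -/
  f0_mono : StrictMonoOn (f 0) (Icc 0 1)
  f0_fixed : ∀ x ∈ Icc (0 : ℝ) 1, f 0 x = x ↔ x = 0 ∨ x = 1
  f0_zero : 1 < unitDeriv (f 0) 0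
  f0_one : unitDeriv (f 0) 1 ∈ Ioo (0 : ℝ) 1
  f0_deriv_ge : ∀ x ∈ Icc (0 : ℝ) 1, unitDeriv (f 0) 1 ≤ unitDeriv (f 0) x
  /-- `f 1` is the affine contraction `x ↦ γ (1 - x)` -/
  γ : ℝ
  γ_ge : unitDeriv (f 0) 1 ≤ γ
  γ_lt : γ < 1
  f1_eq : ∀ x ∈ Icc (0 : ℝ) 1, f 1 x = γ * (1 - x)
  /-- `f 2` is increasing and its fixed points are exactly `0` (repelling) and
  `p₂ ∈ (0,1)` (attracting) -/
  p₂ : ℝ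
  p₂_mem : p₂ ∈ Ioo (0 : ℝ) 1
  f2_mono : StrictMonoOn (f 2) (Icc 0 1)
  f2_fixed : ∀ x ∈ Icc (0 : ℝ) 1, f 2 x = x ↔ x = 0 ∨ x = p₂
  f2_zero : 1 < unitDeriv (f 2) 0
  f2_p₂ : |unitDeriv (f 2) p₂| < 1

namespace SkewProduct

variable (S : SkewProduct)

/-- The planar horseshoe: the maximal invariant set of `Φ` in the union of the sub-cubes. -/
def Gam : Set (ℝ × ℝ) := maxInvariant S.Φ (⋃ i, S.box i)

open Classical in
/-- The index `i` of the sub-cube `box i` containing a given point (and `2` off the sub-cubes, where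
the value is irrelevant). -/
def symb (x : ℝ × ℝ) : Fin 3 :=
  if x ∈ S.box 0 then 0 else if x ∈ S.box 1 then 1 else 2

/-- The skew product `F(x̂, x) = (Φ(x̂), f_i(x))` for `x̂ ∈ box i` and `x ∈ [0,1]`. It is only used
on `dom`, the union of the cubes `box i × [0,1]`. -/
def F (X : (ℝ × ℝ) × ℝ) : (ℝ × ℝ) × ℝ := (S.Φ X.1, S.f (S.symb X.1) X.2)

/-- The union of the three cubes `box i × [0,1]`, the domain of `F`. -/
def dom : Set ((ℝ × ℝ) × ℝ) := (⋃ i, S.box i) ×ˢ Icc 0 1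

/-- The maximal invariant set of `F` in the cube. -/
def Lam : Set ((ℝ × ℝ) × ℝ) := maxInvariant S.F S.dom

/-- The restriction of `F` to `Lam`. -/
def FLam : S.Lam → S.Lam := (maxInvariant_mapsTo S.F S.dom).restrict S.F S.Lam S.Lam

theorem fst_mem_Gam {X : (ℝ × ℝ) × ℝ} (hX : X ∈ S.Lam) : X.1 ∈ S.Gam := by
  obtain ⟨u, rfl, hu⟩ := hX
  exact ⟨fun n => (u n).1, rfl, fun n => ⟨(hu n).1.1, congrArg Prod.fst (hu n).2⟩⟩

/-- The semiconjugation from `Lam` to the shift induced by the skew product structure. -/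
def proj (X : S.Lam) : Sigma3 := S.ϖ ⟨X.1.1, S.fst_mem_Gam X.2⟩

/-- The points of the planar horseshoe coded by a sequence in `{0,2}^ℤ`. -/
def Gam02 : Set (ℝ × ℝ) := Subtype.val '' (S.ϖ ⁻¹' {ξ | ∀ n, ξ n = 0 ∨ ξ n = 2})

/-- The lateral two-legged horseshoe. -/
def Lam02 : Set ((ℝ × ℝ) × ℝ) := S.Gam02 ×ˢ {0}

/-- The potential `log ‖dF|E^c‖ = log |f_i'(x)|` at a point `(x̂, x)` with `x̂ ∈ box i`, where `E^c` is
the direction of the last coordinate. -/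
def logCentral (X : S.Lam) : ℝ := Real.log |unitDeriv (S.f (S.symb X.1.1)) X.1.2|

/-- The central Lyapunov exponent `∫ log ‖dF|E^c‖ dμ` of a measure. -/
def centralExponent (μ : Measure S.Lam) : ℝ := ∫ X, S.logCentral X ∂μ

end SkewProduct

end HorseshoeSkew

end

/-! Both measures are images of the fair coin measure on sequences of Booleans, which code
$\{0,2\}^{\mathbb Z}$, under the graph of an equivariant section of the interval bundle. Any such
graph measure is ergodic, as a factor of a Bernoulli shift, and projects to the
$(\tfrac12,0,\tfrac12)$-Bernoulli measure. Its entropy is $\log 2$: a factor of the 2-shift has at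
most that much, and the zeroth letter, which survives in the factor, already generates that much. So
only the exponents depend on the section.

For $\mu_2$ the section is $0$, a repelling fixed point of both $f_0$ and $f_2$.

For $\mu_1$ it is the upper boundary $u$ of $\Lambda$ over $\{0,2\}^{\mathbb Z}$, the decreasing
limit of $u_n$, the image of $1$ under the last $n$ fibre maps of the past. If $d_n=u_n-u>0$, the
slope of the fibre map between $u$ and $u_n$ is $d_{n+1}\circ\sigma/d_n\le d_n\circ\sigma/d_n$. Its
logarithm is thus dominated by a coboundary and has nonpositive integral
(`integral_nonpos_of_le_coboundary`). As $n\to\infty$ the slopes tend to the derivative at $u$, with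
logarithms uniformly bounded by the mean value theorem, so the exponent is at most $0$. That $d_n>0$
almost surely follows from ergodicity, since $f_2(1)<1$. -/

open scoped symmDiff

namespace HorseshoeSkew

/-! ### Two-sided Bernoulli shifts -/

section Bernoulli

variable {A : Type*}

/-- The left shift on bi-infinite sequences over an arbitrary alphabet. -/
def leftShift (x : ℤ → A) : ℤ → A := fun n => x (n + 1)

@[simp] theorem leftShift_apply (x : ℤ → A) (n : ℤ) : leftShift x n = x (n + 1) := rfl

@[simp] theorem leftShift_iterate_apply (x : ℤ → A) (k : ℕ) (n : ℤ) :
    leftShift^[k] x n = x (n + k) := by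
  induction k generalizing n with
  | zero => simp
  | succ k ih =>
    rw [Function.iterate_succ_apply', leftShift_apply, ih]
    congr 1
    push_cast
    ring

variable [MeasurableSpace A]

theorem measurable_leftShift : Measurable (leftShift : (ℤ → A) → ℤ → A) :=
  measurable_pi_lambda _ fun n => measurable_pi_apply (n + 1)

theorem measurePreserving_leftShift (p : Measure A) [IsProbabilityMeasure p] :
    MeasurePreserving leftShift (Measure.infinitePi fun _ : ℤ => p)
      (Measure.infinitePi fun _ : ℤ => p) :=
  ⟨measurable_leftShift, Measure.map_infinitePi_infinitePi_of_inj (P := fun _ : ℤ => p)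
    (add_left_injective (1 : ℤ))⟩

theorem exists_measurableCylinders_symmDiff_lt (μ : Measure (ℤ → A)) [IsFiniteMeasure μ]
    {s : Set (ℤ → A)} (hs : MeasurableSet s) {ε : ℝ} (hε : 0 < ε) :
    ∃ t ∈ measurableCylinders fun _ : ℤ => A, μ.real (t ∆ s) < ε := by
  obtain ⟨t, ht, h⟩ := exists_measure_symmDiff_lt_of_generateFrom_isSetRing (μ := μ)
    (isSetRing_measurableCylinders (α := fun _ : ℤ => A))
    ⟨{univ}, countable_singleton _, by
      simpa using univ_mem_measurableCylinders fun _ : ℤ => A, by simp⟩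
    generateFrom_measurableCylinders.symm hs (ENNReal.ofReal_pos.2 hε)
  exact ⟨t, ht, (ENNReal.lt_ofReal_iff_toReal_lt (measure_ne_top _ _)).1 h⟩

/-- A large enough shift moves the finite window of the cylinder off itself, and disjoint blocks of
coordinates are independent. -/
theorem exists_measure_inter_leftShift_iterate (p : Measure A) [IsProbabilityMeasure p]
    {t : Set (ℤ → A)} (ht : t ∈ measurableCylinders fun _ : ℤ => A) :
    ∃ k : ℕ, (Measure.infinitePi fun _ : ℤ => p).real (t ∩ leftShift^[k] ⁻¹' t) =
      (Measure.infinitePi fun _ : ℤ => p).real t * (Measure.infinitePi fun _ : ℤ => p).real t := by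
  set ν := Measure.infinitePi fun _ : ℤ => p
  obtain ⟨s, S, hS, rfl⟩ := (mem_measurableCylinders _).1 ht
  obtain ⟨N, hN⟩ : ∃ N : ℕ, ∀ i ∈ s, i.natAbs ≤ N :=
    ⟨s.sup Int.natAbs, fun i hi => Finset.le_sup (f := Int.natAbs) hi⟩
  -- The window lies in $[-N,N]$, so a translation by $2N+1$ makes it disjoint from itself.
  set k := 2 * N + 1
  refine ⟨k, ?_⟩
  set T : Finset ℤ := s.map (addRightEmbedding (k : ℤ))
  have hdisj : Disjoint s T := by
    rw [Finset.disjoint_left]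
    intro i hi hiT
    obtain ⟨j, hj, rfl⟩ := Finset.mem_map.1 hiT
    have h1 := hN _ hi
    have h2 := hN _ hj
    simp only [addRightEmbedding_apply, k] at h1
    omega
  have hind := (ProbabilityTheory.iIndepFun_infinitePi (P := fun _ : ℤ => p)
    (X := fun _ x => x) (fun _ => measurable_id)).indepFun_finset s T hdisj
    (fun i => measurable_pi_apply i)
  have hmem : ∀ i : s, (i : ℤ) + k ∈ T := fun i => Finset.mem_map.2 ⟨i, i.2, rfl⟩
  let R : (T → A) → (s → A) := fun y i => y ⟨i + k, hmem i⟩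
  have hR : Measurable R := measurable_pi_lambda _ fun i => measurable_pi_apply _
  have hpre : leftShift^[k] ⁻¹' cylinder s S =
      (fun (a : ℤ → A) (i : T) => a i) ⁻¹' (R ⁻¹' S) := by
    ext x
    simp only [cylinder, mem_preimage, R]
    congr! 1
    ext i
    simp [Finset.restrict]
  have := hind.measure_inter_preimage_eq_mul S (R ⁻¹' S) hS (hR hS)
  rw [← hpre] at this
  have hmp := ((measurePreserving_leftShift p).iterate k).measure_preimage
    (hS.cylinder (s := s)).nullMeasurableSet
  have h2 : ν (cylinder s S ∩ leftShift^[k] ⁻¹' cylinder s S) =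
      ν (cylinder s S) * ν (cylinder s S) := by
    rw [hmp] at this
    exact this
  simp only [Measure.real, h2, ENNReal.toReal_mul]

/-- An invariant set is approximated by a cylinder that is independent of one of its shifts; hence
the set is independent of itself and its measure solves $m=m^2$. -/
theorem ergodic_leftShift (p : Measure A) [IsProbabilityMeasure p] :
    Ergodic leftShift (Measure.infinitePi fun _ : ℤ => p) := by
  set ν := Measure.infinitePi fun _ : ℤ => p
  refine ⟨measurePreserving_leftShift p, ⟨fun s hs hinv => ?_⟩⟩
  have key : ν.real s = ν.real s * ν.real s := by
    refine eq_of_forall_dist_le fun ε hε => ?_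
    -- With $\varepsilon/4$, both $|\nu(s)-\nu(t)^2|$ and $|\nu(t)^2-\nu(s)^2|$ are at most
    -- $\varepsilon/2$.
    obtain ⟨t, ht, hts⟩ := exists_measurableCylinders_symmDiff_lt ν hs (ε := ε / 4) (by positivity)
    have htm := MeasurableSet.of_mem_measurableCylinders ht
    obtain ⟨k, hk⟩ := exists_measure_inter_leftShift_iterate p ht
    have hkinv : leftShift^[k] ⁻¹' s = s := by
      rw [preimage_iterate_eq]
      exact Function.iterate_fixed hinv k
    have hmk : Measurable (leftShift^[k] : (ℤ → A) → ℤ → A) := measurable_leftShift.iterate k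
    have h1 : |ν.real t - ν.real s| ≤ ν.real (t ∆ s) :=
      abs_measureReal_sub_le_measureReal_symmDiff htm.nullMeasurableSet hs.nullMeasurableSet
    have h2 : |ν.real (t ∩ leftShift^[k] ⁻¹' t) - ν.real s| ≤
        ν.real ((t ∩ leftShift^[k] ⁻¹' t) ∆ s) :=
      abs_measureReal_sub_le_measureReal_symmDiff (htm.inter (hmk htm)).nullMeasurableSet
        hs.nullMeasurableSet
    have h3 : ν.real ((t ∩ leftShift^[k] ⁻¹' t) ∆ s) ≤ ν.real (t ∆ s) + ν.real (t ∆ s) := by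
      have hsub : (t ∩ leftShift^[k] ⁻¹' t) ∆ s ⊆ (t ∆ s) ∪ leftShift^[k] ⁻¹' (t ∆ s) := by
        have h4 : leftShift^[k] ⁻¹' (t ∆ s) = (leftShift^[k] ⁻¹' t) ∆ s := by
          rw [preimage_symmDiff, hkinv]
        rw [h4]
        intro x
        simp only [mem_symmDiff, mem_inter_iff, mem_union]
        tauto
      refine (measureReal_mono hsub).trans ((measureReal_union_le _ _).trans_eq ?_)
      congr 1
      exact ((measurePreserving_leftShift p).iterate k).measureReal_preimage
        (htm.symmDiff hs).nullMeasurableSet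
    rw [hk] at h2
    have ht1 : ν.real t ≤ 1 := measureReal_le_one
    have hs1 : ν.real s ≤ 1 := measureReal_le_one
    have ht0 : 0 ≤ ν.real t := measureReal_nonneg
    have hs0 : 0 ≤ ν.real s := measureReal_nonneg
    rw [Real.dist_eq]
    rw [abs_le] at *
    constructor <;> nlinarith
  have h01 : ν.real s = 0 ∨ ν.real s = 1 := by
    have : ν.real s * (ν.real s - 1) = 0 := by linarith
    rcases mul_eq_zero.1 this with h | h
    · exact .inl h
    · exact .inr (by linarith)
  rw [eventuallyConst_set']
  rcases h01 with h | h
  · exact .inl (ae_eq_empty.2 ((measureReal_eq_zero_iff).1 h))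
  · refine .inr (ae_eq_univ.2 ?_)
    rw [prob_compl_eq_zero_iff hs, ← ENNReal.toReal_eq_one_iff]
    exact h

end Bernoulli

end HorseshoeSkew

namespace HorseshoeSkew

/-! ### Shannon entropy of finite-valued functions -/

section Shannon

variable {α : Type*} [MeasurableSpace α] {ι κ : Type*} [Fintype ι]

/-- Each term is at most the sum and $\log$ is monotone. This is why merging atoms lowers entropy.
-/
theorem negMulLog_sum_le {ι : Type*} (s : Finset ι) {x : ι → ℝ} (hx : ∀ i ∈ s, 0 ≤ x i) :
    Real.negMulLog (∑ i ∈ s, x i) ≤ ∑ i ∈ s, Real.negMulLog (x i) := by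
  rw [Real.negMulLog, ← Finset.sum_neg_distrib, Finset.sum_mul]
  refine Finset.sum_le_sum fun i hi => ?_
  rw [Real.negMulLog]
  rcases (hx i hi).eq_or_lt with h | h
  · simp [← h]
  · have := Real.log_le_log h (Finset.single_le_sum hx hi)
    nlinarith

theorem measureReal_preimage_eq_sum [DecidableEq κ] (μ : Measure α) [IsFiniteMeasure μ]
    {X : α → ι} (hX : ∀ i, MeasurableSet (X ⁻¹' {i})) (f : ι → κ) (k : κ) :
    μ.real ((fun x => f (X x)) ⁻¹' {k}) =
      ∑ i with f i = k, μ.real (X ⁻¹' {i}) := by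
  rw [← measureReal_biUnion_finset]
  · congr 1
    ext x
    simp
  · intro i _ j _ hij
    exact Disjoint.preimage X (disjoint_singleton.2 hij)
  · exact fun i _ => hX i

theorem sum_measureReal_preimage (μ : Measure α) [IsProbabilityMeasure μ]
    {X : α → ι} (hX : ∀ i, MeasurableSet (X ⁻¹' {i})) : ∑ i, μ.real (X ⁻¹' {i}) = 1 := by
  classical
  have := measureReal_preimage_eq_sum μ hX (fun _ => ()) ()
  simpa using this.symm

theorem shannonEntropy_comp_le [Fintype κ] (μ : Measure α) [IsFiniteMeasure μ]
    {X : α → ι} (hX : ∀ i, MeasurableSet (X ⁻¹' {i})) (f : ι → κ) :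
    shannonEntropy μ (fun x => f (X x)) ≤ shannonEntropy μ X := by
  classical
  rw [shannonEntropy, shannonEntropy, ← Finset.sum_fiberwise _ f]
  refine Finset.sum_le_sum fun k _ => ?_
  rw [measureReal_preimage_eq_sum μ hX f k]
  exact negMulLog_sum_le _ fun _ _ => measureReal_nonneg

theorem shannonEntropy_le_of_factorsThrough [Fintype κ] [Nonempty α] (μ : Measure α) [IsFiniteMeasure μ]
    {X : α → ι} (hX : ∀ i, MeasurableSet (X ⁻¹' {i})) {Y : α → κ}
    (h : Function.FactorsThrough Y X) : shannonEntropy μ Y ≤ shannonEntropy μ X := by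
  have : Nonempty κ := Nonempty.map Y inferInstance
  obtain ⟨e, rfl⟩ := (Function.factorsThrough_iff Y).1 h
  exact shannonEntropy_comp_le μ hX e

/-- Termwise Gibbs inequality, from $\log t\le t-1$ at $t=q/p$. Subadditivity of entropy and the
$\log$-cardinality bound both come from summing it. The condition `h` is absolute continuity, needed
because `Real.log 0 = 0`. -/
theorem negMulLog_sub_le {p q : ℝ} (hp : 0 ≤ p) (hq : 0 ≤ q) (h : q = 0 → p = 0) :
    Real.negMulLog p + p * Real.log q ≤ q - p := by
  rcases hp.eq_or_lt with rfl | hp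
  · simpa using hq
  · have hq' : 0 < q := hq.lt_of_ne fun h0 => hp.ne' (h h0.symm)
    have h1 := Real.log_le_sub_one_of_pos (div_pos hq' hp)
    rw [Real.log_div hq'.ne' hp.ne'] at h1
    have h2 : p * (q / p - 1) = q - p := by field_simp
    rw [Real.negMulLog]
    nlinarith

/-- Gibbs inequality for the joint law against the product of its marginals: both have total mass
$1$, so the right-hand sides cancel on summation. -/
theorem shannonEntropy_prodMk_le [Fintype κ] (μ : Measure α) [IsProbabilityMeasure μ]
    {X : α → ι} (hX : ∀ i, MeasurableSet (X ⁻¹' {i}))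
    {Y : α → κ} (hY : ∀ i, MeasurableSet (Y ⁻¹' {i})) :
    shannonEntropy μ (fun x => (X x, Y x)) ≤ shannonEntropy μ X + shannonEntropy μ Y := by
  classical
  have hXY : ∀ i : ι × κ, MeasurableSet ((fun x => (X x, Y x)) ⁻¹' {i}) := by
    rintro ⟨i, j⟩
    convert! (hX i).inter (hY j) using 1
    ext x
    simp
  set p : ι × κ → ℝ := fun i => μ.real ((fun x => (X x, Y x)) ⁻¹' {i})
  set a : ι → ℝ := fun i => μ.real (X ⁻¹' {i})
  set b : κ → ℝ := fun i => μ.real (Y ⁻¹' {i})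
  have ha : ∀ i, a i = ∑ j, p (i, j) := fun i => by
    have := measureReal_preimage_eq_sum μ hXY Prod.fst i
    refine this.trans ?_
    rw [Finset.sum_filter, Fintype.sum_prod_type]
    rw [Finset.sum_eq_single i] <;> simp +contextual [p]
  have hb : ∀ j, b j = ∑ i, p (i, j) := fun i => by
    have := measureReal_preimage_eq_sum μ hXY Prod.snd i
    refine this.trans ?_
    rw [Finset.sum_filter, Fintype.sum_prod_type_right]
    rw [Finset.sum_eq_single i] <;> simp +contextual [p]
  have hp0 : ∀ i, 0 ≤ p i := fun i => measureReal_nonneg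
  have ha0 : ∀ i, 0 ≤ a i := fun i => measureReal_nonneg
  have hb0 : ∀ i, 0 ≤ b i := fun i => measureReal_nonneg
  have hpa : ∀ i j, p (i, j) ≤ a i := fun i j => by
    rw [ha]
    exact Finset.single_le_sum (f := fun j => p (i, j)) (fun j _ => hp0 _) (Finset.mem_univ j)
  have hpb : ∀ i j, p (i, j) ≤ b j := fun i j => by
    rw [hb]
    exact Finset.single_le_sum (f := fun i => p (i, j)) (fun j _ => hp0 _) (Finset.mem_univ i)
  have hkey : ∀ i j, Real.negMulLog (p (i, j)) ≤
      a i * b j - p (i, j) - (p (i, j) * Real.log (a i) + p (i, j) * Real.log (b j)) := by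
    intro i j
    have h1 := negMulLog_sub_le (hp0 (i, j)) (mul_nonneg (ha0 i) (hb0 j)) fun h => by
      rcases mul_eq_zero.1 h with h | h
      · exact le_antisymm (h ▸ hpa i j) (hp0 _)
      · exact le_antisymm (h ▸ hpb i j) (hp0 _)
    rcases (hp0 (i, j)).eq_or_lt with h0 | h0
    · rw [← h0]
      have := mul_nonneg (ha0 i) (hb0 j)
      simpa using this
    · rw [Real.log_mul (h0.trans_le (hpa i j)).ne' (h0.trans_le (hpb i j)).ne'] at h1
      linarith
  have hsum := Finset.sum_le_sum fun i (_ : i ∈ Finset.univ) =>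
    Finset.sum_le_sum fun j (_ : j ∈ Finset.univ) => hkey i j
  have e1 : ∑ i, ∑ j, a i * b j = 1 := by
    rw [← Finset.sum_mul_sum, sum_measureReal_preimage μ hX, sum_measureReal_preimage μ hY, one_mul]
  have e2 : ∑ i, ∑ j, p (i, j) = 1 := by
    rw [← Fintype.sum_prod_type, sum_measureReal_preimage μ hXY]
  have e3 : ∑ i, ∑ j, p (i, j) * Real.log (a i) = -shannonEntropy μ X := by
    rw [shannonEntropy, ← Finset.sum_neg_distrib]
    refine Finset.sum_congr rfl fun i _ => ?_
    rw [← Finset.sum_mul, ← ha, Real.negMulLog]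
    ring
  have e4 : ∑ i, ∑ j, p (i, j) * Real.log (b j) = -shannonEntropy μ Y := by
    rw [shannonEntropy, ← Finset.sum_neg_distrib, Finset.sum_comm]
    refine Finset.sum_congr rfl fun i _ => ?_
    rw [← Finset.sum_mul, ← hb, Real.negMulLog]
    ring
  simp only [Finset.sum_sub_distrib, Finset.sum_add_distrib, e1, e2, e3, e4] at hsum
  rw [shannonEntropy, Fintype.sum_prod_type]
  linarith

theorem measurableSet_preimage_pi {β : Type*} {n : ℕ} {X : Fin n → α → β}
    (hX : ∀ j i, MeasurableSet (X j ⁻¹' {i})) (a : Fin n → β) :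
    MeasurableSet ((fun x j => X j x) ⁻¹' {a}) := by
  have : (fun x j => X j x) ⁻¹' {a} = ⋂ j, X j ⁻¹' {a j} := by
    ext x
    simp [funext_iff]
  rw [this]
  exact .iInter fun j => hX j _

theorem shannonEntropy_pi_le (μ : Measure α) [IsProbabilityMeasure μ] {n : ℕ} {X : Fin n → α → ι}
    (hX : ∀ j i, MeasurableSet (X j ⁻¹' {i})) :
    shannonEntropy μ (fun x j => X j x) ≤ ∑ j, shannonEntropy μ (X j) := by
  classical
  have : Nonempty α := nonempty_of_isProbabilityMeasure μ
  induction n with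
  | zero =>
    have h : ∀ a : Fin 0 → ι, (fun (x : α) (j : Fin 0) => X j x) ⁻¹' {a} = univ := fun a => by
      ext x
      simp [Subsingleton.elim _ a]
    simp [shannonEntropy, h]
  | succ n ih =>
    have hXs := fun (j : Fin n) => hX j.succ
    have h1 := shannonEntropy_prodMk_le μ (hX 0) (measurableSet_preimage_pi hXs)
    have h2 : shannonEntropy μ (fun x j => X j x) ≤
        shannonEntropy μ (fun x => (X 0 x, fun j : Fin n => X j.succ x)) := by
      refine shannonEntropy_le_of_factorsThrough μ ?_ ?_
      · rintro ⟨i, a⟩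
        convert! (hX 0 i).inter (measurableSet_preimage_pi hXs a) using 1
        ext x
        simp
      · intro x y hxy
        simp only [Prod.mk.injEq, funext_iff] at hxy ⊢
        exact Fin.cases hxy.1 hxy.2
    rw [Fin.sum_univ_succ]
    linarith [ih hXs]

/-- Gibbs inequality against the uniform law. -/
theorem shannonEntropy_le_log_card (μ : Measure α) [IsProbabilityMeasure μ]
    {X : α → ι} (hX : ∀ i, MeasurableSet (X ⁻¹' {i})) :
    shannonEntropy μ X ≤ Real.log (Fintype.card ι) := by
  have h := sum_measureReal_preimage μ hX
  have hι : Nonempty ι := Nonempty.map X (nonempty_of_isProbabilityMeasure μ)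
  have hc : (0 : ℝ) < Fintype.card ι := by exact_mod_cast Fintype.card_pos
  have hs := Finset.sum_le_sum fun i (_ : i ∈ Finset.univ) =>
    negMulLog_sub_le (p := μ.real (X ⁻¹' {i})) (q := (Fintype.card ι : ℝ)⁻¹) measureReal_nonneg
      (by positivity) (fun h0 => absurd h0 (by positivity))
  rw [Finset.sum_add_distrib, Finset.sum_sub_distrib, ← Finset.sum_mul, h] at hs
  simp only [Real.log_inv, Finset.sum_const, Finset.card_univ, nsmul_eq_mul,
    mul_inv_cancel₀ hc.ne'] at hs
  rw [shannonEntropy]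
  linarith

theorem shannonEntropy_bool (μ : Measure α) [IsProbabilityMeasure μ] {X : α → Bool}
    (hX : ∀ i, MeasurableSet (X ⁻¹' {i})) :
    shannonEntropy μ X = Real.binEntropy (μ.real (X ⁻¹' {true})) := by
  have h := sum_measureReal_preimage μ hX
  rw [Fintype.sum_bool] at h
  rw [shannonEntropy, Fintype.sum_bool, Real.binEntropy_eq_negMulLog_add_negMulLog_one_sub,
    ← h, add_sub_cancel_left]

theorem shannonEntropy_map {β : Type*} [MeasurableSpace β] {μ : Measure α} {Ψ : α → β}
    (hΨ : Measurable Ψ) {Q : β → ι} (hQ : ∀ i, MeasurableSet (Q ⁻¹' {i})) :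
    shannonEntropy (μ.map Ψ) Q = shannonEntropy μ (fun x => Q (Ψ x)) := by
  refine Finset.sum_congr rfl fun i _ => ?_
  rw [map_measureReal_apply hΨ (hQ i)]
  rfl

end Shannon

end HorseshoeSkew

namespace HorseshoeSkew

/-! ### Entropy of shifts -/

section ShiftEntropy

variable {A : Type*} [MeasurableSpace A]

/-- A measurable partition of a shift space is, up to a partition into sets of small measure,
determined by finitely many coordinates. -/
theorem exists_window_determines (μ : Measure (ℤ → A)) [IsProbabilityMeasure μ] {k : ℕ}
    {Q : (ℤ → A) → Fin k} (hQ : Measurable Q) {ε : ℝ} (hε : 0 < ε) :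
    ∃ (N : ℕ) (D : (ℤ → A) → Fin k → Bool), (∀ i, MeasurableSet (D ⁻¹' {i})) ∧
      shannonEntropy μ D ≤ k * ε ∧
      ∀ x y, (∀ i : ℤ, i.natAbs ≤ N → x i = y i) → D x = D y → Q x = Q y := by
  classical
  obtain ⟨δ, hδ, hδε⟩ : ∃ δ > 0, ∀ x : ℝ, |x| < δ → Real.binEntropy x ≤ ε := by
    have := Metric.continuousAt_iff.1 (Real.binEntropy_continuous.continuousAt (x := 0)) ε hε
    obtain ⟨δ, hδ, h⟩ := this
    refine ⟨δ, hδ, fun x hx => ?_⟩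
    have h1 := h (x := x) (by simpa [Real.dist_eq] using hx)
    rw [Real.binEntropy_zero, Real.dist_eq, sub_zero] at h1
    exact (le_abs_self _).trans h1.le
  have hQm : ∀ i, MeasurableSet (Q ⁻¹' {i}) := fun i => hQ (measurableSet_singleton i)
  choose t ht htδ using fun i => exists_measurableCylinders_symmDiff_lt μ (hQm i) hδ
  choose s S hS hts using fun i => (mem_measurableCylinders _).1 (ht i)
  have htm : ∀ i, MeasurableSet (t i) := fun i => MeasurableSet.of_mem_measurableCylinders (ht i)
  obtain ⟨N, hN⟩ : ∃ N : ℕ, ∀ i, ∀ j ∈ s i, j.natAbs ≤ N :=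
    ⟨Finset.univ.sup fun i => (s i).sup Int.natAbs, fun i j hj =>
      (Finset.le_sup (f := Int.natAbs) hj).trans
        (Finset.le_sup (f := fun i => (s i).sup Int.natAbs) (Finset.mem_univ i))⟩
  -- `D i` flags the points where the cylinder `t i` misjudges the atom `i`; such a rare event
  -- carries entropy at most `ε`.
  let D : Fin k → (ℤ → A) → Bool := fun i x => decide (x ∈ t i ∆ (Q ⁻¹' {i}))
  have hDtrue : ∀ i, D i ⁻¹' {true} = t i ∆ (Q ⁻¹' {i}) := fun i => by
    ext x
    simp [D]
  have hDm : ∀ i b, MeasurableSet (D i ⁻¹' {b}) := fun i b => by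
    have h1 : MeasurableSet (D i ⁻¹' {true}) := by
      rw [hDtrue]
      exact (htm i).symmDiff (hQm i)
    cases b
    · convert! h1.compl using 1
      ext x
      simp
    · exact h1
  refine ⟨N, fun x i => D i x, measurableSet_preimage_pi hDm, ?_, fun x y hxy hD => ?_⟩
  · refine (shannonEntropy_pi_le μ hDm).trans ?_
    refine (Finset.sum_le_card_nsmul _ _ ε fun i _ => ?_).trans (by simp)
    rw [shannonEntropy_bool μ (hDm i), hDtrue]
    exact hδε _ (by rw [abs_of_nonneg measureReal_nonneg]; exact htδ i)
  · have hti : ∀ i, (x ∈ t i ↔ y ∈ t i) := fun i => by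
      rw [hts i, mem_cylinder, mem_cylinder]
      have : (s i).restrict x = (s i).restrict y := by
        ext j
        exact hxy j (hN i j j.2)
      rw [this]
    -- For the index `Q x`, equal cylinder membership and equal error flags force equal membership
    -- in the atom.
    have h1 := congrFun hD (Q x)
    simp only [D, decide_eq_decide, mem_symmDiff, hti, mem_preimage, mem_singleton_iff] at h1
    by_contra hne
    have hne' : ¬ Q y = Q x := fun h => hne h.symm
    tauto

/-- The word on $[-N,n+N]$ together with the error flags at the $n$ times determines the itinerary.
Each letter costs at most $\log|A|$ and, by invariance, each flag vector at most $k\varepsilon$. -/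
theorem shannonEntropy_itinerary_leftShift_le [Fintype A] [MeasurableSingletonClass A]
    (μ : Measure (ℤ → A))
    [IsProbabilityMeasure μ] (hμ : MeasurePreserving leftShift μ μ) {k : ℕ}
    {Q : (ℤ → A) → Fin k} (hQ : Measurable Q) {ε : ℝ} (hε : 0 < ε) :
    ∃ N : ℕ, ∀ n, shannonEntropy μ (itinerary leftShift Q n) ≤
      (n + (2 * N + 1)) * Real.log (Fintype.card A) + n * (k * ε) := by
  classical
  have : Nonempty (ℤ → A) := nonempty_of_isProbabilityMeasure μ
  obtain ⟨N, D, hD, hDε, hdet⟩ := exists_window_determines μ hQ hε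
  refine ⟨N, fun n => ?_⟩
  let V : (ℤ → A) → Fin (n + (2 * N + 1)) → A := fun x j => x ((j : ℕ) - N)
  let E : (ℤ → A) → Fin n → Fin k → Bool := fun x j => D (leftShift^[j] x)
  have hV : ∀ a, MeasurableSet (V ⁻¹' {a}) := measurableSet_preimage_pi fun j i =>
    measurable_pi_apply _ (measurableSet_singleton i)
  have hEj : ∀ (j : Fin n) i, MeasurableSet ((fun x => D (leftShift^[j] x)) ⁻¹' {i}) :=
    fun j i => measurable_leftShift.iterate j (hD i)
  have hE : ∀ a, MeasurableSet (E ⁻¹' {a}) := measurableSet_preimage_pi hEj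
  have hVE : ∀ a, MeasurableSet ((fun x => (V x, E x)) ⁻¹' {a}) := by
    rintro ⟨a, b⟩
    convert! (hV a).inter (hE b) using 1
    ext x
    simp
  have h1 : shannonEntropy μ (itinerary leftShift Q n) ≤
      shannonEntropy μ (fun x => (V x, E x)) := by
    refine shannonEntropy_le_of_factorsThrough μ hVE fun x y hxy => ?_
    obtain ⟨hVxy, hExy⟩ := Prod.mk.inj hxy
    ext1 j
    refine hdet _ _ (fun i hi => ?_) (congrFun hExy j)
    have hj := j.2
    have h2 := congrFun hVxy ⟨(i + j + N).toNat, by omega⟩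
    have h3 : (((i + j + N).toNat : ℕ) : ℤ) - N = i + (j : ℕ) := by omega
    simp only [V, h3] at h2
    simpa using h2
  have h2 := shannonEntropy_prodMk_le μ hV hE
  have h3 := shannonEntropy_le_log_card μ hV
  have h4 : shannonEntropy μ E ≤ n * (k * ε) := by
    refine (shannonEntropy_pi_le μ hEj).trans ?_
    refine (Finset.sum_le_card_nsmul _ _ (k * ε) fun j _ => ?_).trans (by simp)
    rw [← shannonEntropy_map (measurable_leftShift.iterate j) hD, (hμ.iterate j).map_eq]
    exact hDε
  rw [Fintype.card_fun, Fintype.card_fin, Nat.cast_pow, Real.log_pow] at h3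
  push_cast at h3
  linarith

/-- The entropy of a shift-invariant measure is at most the logarithm of the size of the
alphabet. -/
theorem partitionEntropy_leftShift_le [Fintype A] [MeasurableSingletonClass A]
    (μ : Measure (ℤ → A))
    [IsProbabilityMeasure μ] (hμ : MeasurePreserving leftShift μ μ) {k : ℕ}
    {Q : (ℤ → A) → Fin k} (hQ : Measurable Q) :
    partitionEntropy μ leftShift Q ≤ (Real.log (Fintype.card A) : ℝ) := by
  set L := Real.log (Fintype.card A)
  refine EReal.le_of_forall_lt_iff_le.1 fun c hc => ?_
  have hc : L < c := EReal.coe_lt_coe_iff.1 hc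
  -- Half of the gap $c-L$ pays for $k\varepsilon$, the other half for the boundary term
  -- $(2N+1)L/n$.
  set ε := (c - L) / (2 * (k + 1)) with hε_def
  have hε : 0 < ε := div_pos (by linarith) (by positivity)
  obtain ⟨N, hN⟩ := shannonEntropy_itinerary_leftShift_le μ hμ hQ hε
  have hlim : Tendsto (fun n : ℕ => (2 * N + 1) * L / n) atTop (𝓝 0) :=
    tendsto_const_div_atTop_nhds_zero_nat _
  refine limsup_le_of_le (by isBoundedDefault) ?_
  filter_upwards [hlim.eventually_lt_const (show 0 < (c - L) / 2 by linarith),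
    eventually_gt_atTop 0] with n hn hn0
  have hn0 : (0 : ℝ) < n := by exact_mod_cast hn0
  rw [EReal.coe_le_coe_iff, div_le_iff₀ hn0]
  rw [div_lt_iff₀ hn0] at hn
  have hkε : k * ε ≤ (c - L) / 2 := by
    rw [hε_def, mul_div_assoc', div_le_div_iff₀ (by positivity) two_pos]
    nlinarith
  nlinarith [hN n]

/-- All $|A|^n$ words are equally likely. -/
theorem shannonEntropy_word [Fintype A] [MeasurableSingletonClass A]
    (p : Measure A) [IsProbabilityMeasure p]
    (hp : ∀ a, p.real {a} = (Fintype.card A : ℝ)⁻¹) (n : ℕ) :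
    shannonEntropy (Measure.infinitePi fun _ : ℤ => p) (fun x (j : Fin n) => x (j : ℕ)) =
      n * Real.log (Fintype.card A) := by
  classical
  have : Nonempty A := nonempty_of_isProbabilityMeasure p
  have hc : (Fintype.card A : ℝ) ≠ 0 := by exact_mod_cast Fintype.card_ne_zero
  have hatom : ∀ a : Fin n → A, (Measure.infinitePi fun _ : ℤ => p).real
      ((fun x (j : Fin n) => x (j : ℕ)) ⁻¹' {a}) = ((Fintype.card A : ℝ) ^ n)⁻¹ := by
    intro a
    have hinj : Function.Injective fun j : Fin n => ((j : ℕ) : ℤ) :=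
      fun i j h => Fin.ext (Int.ofNat_inj.1 h)
    have hmap := Measure.map_infinitePi_infinitePi_of_inj (P := fun _ : ℤ => p) hinj
    rw [← map_measureReal_apply (by fun_prop) (measurableSet_singleton a), hmap, Measure.real,
      Measure.infinitePi_singleton_of_fintype, ENNReal.toReal_prod]
    have hp' : ∀ a, (p {a}).toReal = (Fintype.card A : ℝ)⁻¹ := hp
    simp [hp']
  simp only [shannonEntropy, hatom, Finset.sum_const, Finset.card_univ, Fintype.card_fun,
    Fintype.card_fin, nsmul_eq_mul, Real.negMulLog, Real.log_inv, Real.log_pow]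
  push_cast
  field_simp

end ShiftEntropy

end HorseshoeSkew

noncomputable section

namespace HorseshoeSkew

/-- A factor of a uniform Bernoulli shift that remembers the zeroth letter has entropy
the logarithm of the size of the alphabet. -/
theorem metricEntropy_map_leftShift {A β : Type*} [Fintype A] [MeasurableSpace A]
    [MeasurableSingletonClass A] [MeasurableSpace β]
    (p : Measure A) [IsProbabilityMeasure p] (hp : ∀ a, p.real {a} = (Fintype.card A : ℝ)⁻¹)
    {T : β → β} (hT : Measurable T) {Ψ : (ℤ → A) → β} (hΨ : Measurable Ψ)
    (hconj : Function.Semiconj Ψ leftShift T) {k : ℕ} {P : β → Fin k} (hP : Measurable P)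
    {c : A → Fin k} (hc : Function.Injective c) (hPc : ∀ x, P (Ψ x) = c (x 0)) :
    metricEntropy ((Measure.infinitePi fun _ : ℤ => p).map Ψ) T =
      (Real.log (Fintype.card A) : ℝ) := by
  set ν := Measure.infinitePi fun _ : ℤ => p
  have : Nonempty (ℤ → A) := nonempty_of_isProbabilityMeasure ν
  have hitin : ∀ {l : ℕ} {Q : β → Fin l}, Measurable Q → ∀ n,
      shannonEntropy (ν.map Ψ) (itinerary T Q n) =
        shannonEntropy ν (itinerary leftShift (fun x => Q (Ψ x)) n) := by
    intro l Q hQ n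
    rw [shannonEntropy_map hΨ]
    · congr 1
      ext x j
      rw [itinerary, itinerary, (hconj.iterate_right j).eq]
    · exact measurableSet_preimage_pi fun j i =>
        hQ.comp (hT.iterate j) (measurableSet_singleton i)
  refine le_antisymm (iSup_le fun l => iSup_le fun Q => iSup_le fun hQ => ?_) ?_
  · have := partitionEntropy_leftShift_le ν (measurePreserving_leftShift p) (hQ.comp hΨ)
    simpa only [partitionEntropy, hitin hQ, Function.comp_def] using this
  · refine le_iSup_of_le k (le_iSup_of_le P (le_iSup_of_le hP ?_))
    refine le_limsup_of_frequently_le (Eventually.frequently ?_) (by isBoundedDefault)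
    filter_upwards [eventually_gt_atTop 0] with n hn
    have hn : (0 : ℝ) < n := by exact_mod_cast hn
    rw [EReal.coe_le_coe_iff, le_div_iff₀ hn, mul_comm, ← shannonEntropy_word p hp, hitin hP]
    -- The itinerary for `P` reveals the word $x_0\dots x_{n-1}$, since `c` is injective.
    refine shannonEntropy_le_of_factorsThrough ν ?_ fun x y hxy => ?_
    · exact measurableSet_preimage_pi fun j i =>
        (hP.comp hΨ).comp (measurable_leftShift.iterate j) (measurableSet_singleton i)
    · ext1 j
      have := congrFun hxy j
      simp only [itinerary, hPc] at this
      simpa using hc this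

/-! ### Coding the lateral symbols -/

/-- The symbols `0` and `2`, indexed by the Booleans. -/
def letter (b : Bool) : Fin 3 := bif b then 2 else 0

theorem letter_injective : Function.Injective letter := by decide

theorem letter_eq (b : Bool) : letter b = 0 ∨ letter b = 2 := by
  cases b <;> simp [letter]

/-- The fair coin. -/
def coin : Measure Bool := (PMF.uniformOfFintype Bool).toMeasure

instance : IsProbabilityMeasure coin := by
  unfold coin
  infer_instance

theorem coin_real_singleton (b : Bool) : coin.real {b} = (Fintype.card Bool : ℝ)⁻¹ := by
  rw [coin, Measure.real, PMF.toMeasure_apply_singleton _ _ (measurableSet_singleton b)]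
  simp

/-- The Bernoulli measure of the fair coin. -/
def coinFlips : Measure (ℤ → Bool) := Measure.infinitePi fun _ => coin

instance : IsProbabilityMeasure coinFlips := by
  unfold coinFlips
  infer_instance

theorem ergodic_coinFlips : Ergodic leftShift coinFlips := ergodic_leftShift coin

/-- The sequence in `{0,2}^ℤ` given by a sequence of Booleans. -/
def lateralWord (w : ℤ → Bool) : Sigma3 := fun n => letter (w n)

theorem measurable_lateralWord : Measurable lateralWord :=
  measurable_pi_lambda _ fun n => (measurable_of_finite letter).comp (measurable_pi_apply n)

theorem shift_lateralWord (w : ℤ → Bool) : shift (lateralWord w) = lateralWord (leftShift w) := rfl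

theorem map_lateralWord : coinFlips.map lateralWord = bernoulliMeasure halfZeroHalf := by
  have h : coin.map letter = halfZeroHalf.toMeasure := by
    rw [coin, PMF.toMeasure_map (hf := measurable_of_finite letter)]
    congr 1
    ext i
    fin_cases i <;> simp [halfZeroHalf, PMF.map_apply, letter]
  have h2 := Measure.infinitePi_map_pi (fun _ : ℤ => coin)
    (f := fun _ => letter) fun _ => measurable_of_finite letter
  simp only [h] at h2
  exact h2

/-! ### Invariant sections over $\{0,2\}^{\mathbb Z}$ and their graph measures -/

namespace SkewProduct

variable (S : SkewProduct)

theorem symb_eq {x : ℝ × ℝ} (hx : x ∈ S.Gam) : S.symb x = S.ϖ ⟨x, hx⟩ 0 := by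
  have h := S.mem_box_iff ⟨x, hx⟩
  simp only at h
  unfold symb
  rw [h 0, h 1]
  generalize S.ϖ ⟨x, hx⟩ 0 = i
  fin_cases i <;> simp

theorem Φ_symm_shift (ξ : Sigma3) :
    S.Φ (S.ϖ.symm ξ : ℝ × ℝ) = (S.ϖ.symm (shift ξ) : ℝ × ℝ) := by
  have hy := maxInvariant_mapsTo S.Φ (⋃ i, S.box i) (S.ϖ.symm ξ).2
  have h := S.ϖ_conj (S.ϖ.symm ξ) ⟨_, hy⟩ rfl
  rw [S.ϖ.apply_symm_apply] at h
  rw [← h, S.ϖ.symm_apply_apply]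

theorem mem_iUnion_box {x : ℝ × ℝ} (hx : x ∈ S.Gam) : x ∈ ⋃ i, S.box i := by
  obtain ⟨u, rfl, hu⟩ := hx
  exact (hu 0).1

theorem snd_mem_Icc (X : S.Lam) : X.1.2 ∈ Icc (0 : ℝ) 1 := by
  obtain ⟨u, hu0, hu⟩ := X.2
  rw [← hu0]
  exact (hu 0).1.2

/-- The boxes need not be Borel sets; measurability of the symbol over `Lam` is obtained from
continuity of `proj`. -/
theorem symb_eq_proj (X : S.Lam) : S.symb X.1.1 = S.proj X 0 := S.symb_eq (S.fst_mem_Gam X.2)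

/-- An equivariant section of the interval bundle over the sequences in `{0,2}^ℤ`. -/
structure IsInvariantSection (φ : (ℤ → Bool) → ℝ) : Prop where
  measurable : Measurable φ
  mem_Icc : ∀ w, φ w ∈ Icc (0 : ℝ) 1
  map_leftShift : ∀ w, φ (leftShift w) = S.f (letter (w 0)) (φ w)

variable {S} {φ : (ℤ → Bool) → ℝ}

theorem IsInvariantSection.mem_Lam (hφ : S.IsInvariantSection φ) (w : ℤ → Bool) :
    ((S.ϖ.symm (lateralWord w) : ℝ × ℝ), φ w) ∈ S.Lam := by
  -- `v n` is the $n$-th shift of `w`, also for negative $n$; the section over it supplies the full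
  -- orbit.
  let v : ℤ → ℤ → Bool := fun n m => w (m + n)
  have hv : ∀ n, leftShift (v n) = v (n + 1) := fun n => by
    ext m
    simp only [leftShift_apply, v]
    congr 1
    ring
  refine ⟨fun n => ((S.ϖ.symm (lateralWord (v n)) : ℝ × ℝ), φ (v n)), by simp [v], fun n => ?_⟩
  refine ⟨⟨S.mem_iUnion_box (S.ϖ.symm (lateralWord (v n))).2, hφ.mem_Icc _⟩, ?_⟩
  have hs : S.symb (S.ϖ.symm (lateralWord (v n))) = letter (v n 0) := by
    rw [S.symb_eq (S.ϖ.symm (lateralWord (v n))).2]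
    exact congrFun (S.ϖ.apply_symm_apply (lateralWord (v n))) 0
  simp only [F, hs, S.Φ_symm_shift, shift_lateralWord, hv, ← hφ.map_leftShift]

/-- The graph of an invariant section over the sequences in `{0,2}^ℤ`. -/
def IsInvariantSection.graph (hφ : S.IsInvariantSection φ) (w : ℤ → Bool) : S.Lam :=
  ⟨_, hφ.mem_Lam w⟩

theorem IsInvariantSection.measurable_graph (hφ : S.IsInvariantSection φ) :
    Measurable hφ.graph := by
  refine Measurable.subtype_mk (Measurable.prodMk ?_ hφ.measurable)
  exact measurable_subtype_coe.comp (S.ϖ.symm.continuous.measurable.comp measurable_lateralWord)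

theorem IsInvariantSection.proj_graph (hφ : S.IsInvariantSection φ) (w : ℤ → Bool) :
    S.proj (hφ.graph w) = lateralWord w :=
  S.ϖ.apply_symm_apply _

theorem IsInvariantSection.symb_graph (hφ : S.IsInvariantSection φ) (w : ℤ → Bool) :
    S.symb (hφ.graph w).1.1 = letter (w 0) := by
  rw [symb_eq_proj, hφ.proj_graph]
  rfl

theorem IsInvariantSection.semiconj_graph (hφ : S.IsInvariantSection φ) :
    Function.Semiconj hφ.graph leftShift S.FLam := by
  intro w
  refine Subtype.ext (Prod.ext ?_ ?_)
  · exact (S.Φ_symm_shift (lateralWord w)).symm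
  · refine (hφ.map_leftShift w).trans ?_
    rw [← hφ.symb_graph]
    rfl

variable (S)

theorem continuous_proj : Continuous S.proj :=
  S.ϖ.continuous.comp (Continuous.subtype_mk (continuous_fst.comp continuous_subtype_val) _)

theorem continuousOn_unitDeriv (i : Fin 3) : ContinuousOn (unitDeriv (S.f i)) (Icc 0 1) :=
  (S.contDiffOn_f i).continuousOn_derivWithin (uniqueDiffOn_Icc zero_lt_one) le_rfl

theorem continuousOn_log_unitDeriv (i : Fin 3) :
    ContinuousOn (fun x => Real.log |unitDeriv (S.f i) x|) (Icc 0 1) :=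
  (S.continuousOn_unitDeriv i).abs.log fun x hx => abs_ne_zero.2 (S.unitDeriv_f_ne_zero i x hx)

/-- A fibrewise function that is continuous over each symbol is measurable. -/
theorem measurable_symb_comp {h : Fin 3 → ℝ → ℝ} (hh : ∀ i, ContinuousOn (h i) (Icc 0 1)) :
    Measurable fun X : S.Lam => h (S.symb X.1.1) X.1.2 := by
  have h1 : Measurable fun X : S.Lam => S.proj X 0 :=
    (measurable_pi_apply 0).comp S.continuous_proj.measurable
  have h2 : ∀ i, Measurable fun X : S.Lam => h i X.1.2 := fun i => by
    have hc : Continuous fun X : S.Lam => h i X.1.2 :=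
      (hh i).comp_continuous (continuous_snd.comp continuous_subtype_val) S.snd_mem_Icc
    exact hc.measurable
  have h3 : (fun X : S.Lam => h (S.symb X.1.1) X.1.2) =
      (fun q : Fin 3 × S.Lam => h q.1 q.2.1.2) ∘ fun X => (S.proj X 0, X) := by
    ext X
    simp [S.symb_eq_proj]
  rw [h3]
  exact (measurable_from_prod_countable_right h2).comp (h1.prodMk measurable_id)

theorem measurable_logCentral : Measurable S.logCentral :=
  S.measurable_symb_comp S.continuousOn_log_unitDeriv

theorem exists_logCentral_bound : ∃ C, ∀ i, ∀ x ∈ Icc (0 : ℝ) 1,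
    |Real.log (|unitDeriv (S.f i) x|)| ≤ C := by
  choose C hC using fun i =>
    isCompact_Icc.exists_bound_of_continuousOn (S.continuousOn_log_unitDeriv i)
  refine ⟨∑ i, |C i|, fun i x hx => (hC i x hx).trans ((le_abs_self _).trans ?_)⟩
  exact Finset.single_le_sum (f := fun i => |C i|) (fun _ _ => abs_nonneg _) (Finset.mem_univ i)

theorem measurable_FLam : Measurable S.FLam := by
  have h1 : Measurable fun X : S.Lam => S.Φ X.1.1 :=
    S.contDiff_Φ.continuous.measurable.comp (measurable_fst.comp measurable_subtype_coe)
  have h2 := S.measurable_symb_comp fun i => (S.contDiffOn_f i).continuousOn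
  exact (h1.prodMk h2).subtype_mk

variable {S}

/-- The image of the fair Bernoulli measure on the graph of an invariant section. -/
def IsInvariantSection.graphMeasure (hφ : S.IsInvariantSection φ) : Measure S.Lam :=
  coinFlips.map hφ.graph

instance (hφ : S.IsInvariantSection φ) : IsProbabilityMeasure hφ.graphMeasure :=
  Measure.isProbabilityMeasure_map hφ.measurable_graph.aemeasurable

theorem IsInvariantSection.ergodic_graphMeasure (hφ : S.IsInvariantSection φ) :
    Ergodic S.FLam hφ.graphMeasure :=
  MeasurePreserving.ergodic_of_ergodic_semiconj ⟨hφ.measurable_graph, rfl⟩ ergodic_coinFlips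
    S.measurable_FLam hφ.semiconj_graph

theorem IsInvariantSection.metricEntropy_graphMeasure (hφ : S.IsInvariantSection φ) :
    metricEntropy hφ.graphMeasure S.FLam = (Real.log 2 : ℝ) := by
  have := metricEntropy_map_leftShift coin coin_real_singleton S.measurable_FLam
    hφ.measurable_graph hφ.semiconj_graph
    (P := fun X => S.proj X 0) ((measurable_pi_apply 0).comp S.continuous_proj.measurable)
    letter_injective (fun w => by rw [hφ.proj_graph]; rfl)
  rwa [Fintype.card_bool] at this

theorem IsInvariantSection.map_proj_graphMeasure (hφ : S.IsInvariantSection φ) :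
    hφ.graphMeasure.map S.proj = bernoulliMeasure halfZeroHalf := by
  rw [graphMeasure, Measure.map_map S.continuous_proj.measurable hφ.measurable_graph,
    ← map_lateralWord]
  congr 1
  ext1 w
  exact hφ.proj_graph w

theorem integrable_logCentral (μ : Measure S.Lam) [IsFiniteMeasure μ] :
    Integrable S.logCentral μ := by
  obtain ⟨C, hC⟩ := S.exists_logCentral_bound
  exact .of_bound S.measurable_logCentral.aestronglyMeasurable C
    (.of_forall fun X => hC _ _ (S.snd_mem_Icc X))

theorem IsInvariantSection.centralExponent_graphMeasure (hφ : S.IsInvariantSection φ) :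
    S.centralExponent hφ.graphMeasure =
      ∫ w, Real.log |unitDeriv (S.f (letter (w 0))) (φ w)| ∂coinFlips := by
  rw [centralExponent, graphMeasure, integral_map hφ.measurable_graph.aemeasurable
    S.measurable_logCentral.aestronglyMeasurable]
  congr 1
  ext1 w
  rw [logCentral, hφ.symb_graph]
  rfl

theorem IsInvariantSection.measurable_log_unitDeriv (hφ : S.IsInvariantSection φ) :
    Measurable fun w : ℤ → Bool => Real.log |unitDeriv (S.f (letter (w 0))) (φ w)| := by
  convert S.measurable_logCentral.comp hφ.measurable_graph using 1
  ext1 w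
  rw [Function.comp_apply, logCentral, hφ.symb_graph]
  rfl

end SkewProduct

end HorseshoeSkew

end

noncomputable section

/-! ### Coboundaries and the two central exponents -/

namespace HorseshoeSkew

/-- A function dominated by a coboundary, of a possibly non-integrable function, has nonpositive
integral. -/
theorem integral_nonpos_of_le_coboundary {α : Type*} [MeasurableSpace α] {μ : Measure α}
    [IsFiniteMeasure μ] {T : α → α} (hT : MeasurePreserving T μ μ) {h s : α → ℝ}
    (hh : Measurable h) (hh0 : ∀ x, h x ≤ 0) (hs : Integrable s μ)
    (hsh : ∀ᵐ x ∂μ, s x ≤ h (T x) - h x) : ∫ x, s x ∂μ ≤ 0 := by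
  -- `h` need not be integrable, but its truncation at $-K$ is bounded, so the coboundary of the
  -- truncation integrates to zero.
  let t : ℕ → α → ℝ := fun K x => max (h x) (-K)
  have htm : ∀ K, Measurable (t K) := fun K => hh.max measurable_const
  have hti : ∀ K, Integrable (t K) μ := fun K =>
    .of_bound (htm K).aestronglyMeasurable K (.of_forall fun x => by
      rw [Real.norm_eq_abs, abs_le]
      exact ⟨le_max_right _ _, max_le ((hh0 x).trans K.cast_nonneg)
        (neg_nonpos.2 K.cast_nonneg |>.trans K.cast_nonneg)⟩)
  have hAm : ∀ K : ℕ, MeasurableSet {x | -(K : ℝ) ≤ h x} := fun K =>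
    measurableSet_le measurable_const hh
  have hle : ∀ K : ℕ, ∫ x, {x | -(K : ℝ) ≤ h x}.indicator s x ∂μ ≤ 0 := fun K => by
    have h1 : ∫ x, (t K (T x) - t K x) ∂μ = 0 := by
      have h2 : ∫ x, t K (T x) ∂μ = ∫ x, t K x ∂μ := by
        conv_rhs => rw [← hT.map_eq]
        rw [integral_map hT.measurable.aemeasurable (htm K).aestronglyMeasurable]
      have h3 : Integrable (fun x => t K (T x)) μ := hT.integrable_comp_of_integrable (hti K)
      rw [integral_sub h3 (hti K), h2, sub_self]
    rw [← h1]
    refine integral_mono_ae (hs.indicator (hAm K))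
      ((hT.integrable_comp_of_integrable (hti K)).sub (hti K)) ?_
    filter_upwards [hsh] with x hx
    -- Where $h\ge -K$, truncating can only raise $h\circ T$. Elsewhere the truncation sits at its
    -- minimum $-K$, so its increment is nonnegative.
    by_cases hxK : -(K : ℝ) ≤ h x
    · rw [indicator_of_mem (show x ∈ {x | -(K : ℝ) ≤ h x} from hxK)]
      simp only [t, max_eq_left hxK]
      exact hx.trans (sub_le_sub_right (le_max_left _ _) _)
    · rw [indicator_of_notMem (show x ∉ {x | -(K : ℝ) ≤ h x} from hxK)]
      simp only [t, max_eq_right (not_le.1 hxK).le]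
      exact sub_nonneg.2 (le_max_right _ _)
  have hlim : Tendsto (fun K : ℕ => ∫ x, {x | -(K : ℝ) ≤ h x}.indicator s x ∂μ) atTop
      (𝓝 (∫ x, s x ∂μ)) := by
    refine tendsto_integral_of_dominated_convergence (fun x => |s x|)
      (fun K => (hs.indicator (hAm K)).aestronglyMeasurable) hs.abs
      (fun K => .of_forall fun x => norm_indicator_le_norm_self _ _) (.of_forall fun x => ?_)
    refine tendsto_const_nhds.congr' ?_
    filter_upwards [eventually_ge_atTop ⌈-h x⌉₊] with K hK
    rw [indicator_of_mem]
    exact neg_le.1 (Nat.ceil_le.1 hK)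
  exact le_of_tendsto' hlim hle

/-- The inverse of the left shift. -/
def rightShift {A : Type*} (x : ℤ → A) : ℤ → A := fun n => x (n - 1)

theorem leftShift_rightShift {A : Type*} (x : ℤ → A) : leftShift (rightShift x) = x := by
  ext n
  simp [rightShift]

theorem rightShift_leftShift {A : Type*} (x : ℤ → A) : rightShift (leftShift x) = x := by
  ext n
  simp [rightShift]

theorem measurePreserving_rightShift :
    MeasurePreserving rightShift coinFlips coinFlips :=
  ⟨measurable_pi_lambda _ fun n => measurable_pi_apply (n - 1),
    Measure.map_infinitePi_infinitePi_of_inj (P := fun _ : ℤ => coin)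
      (sub_left_injective (b := (1 : ℤ)))⟩

namespace SkewProduct

variable (S : SkewProduct)

/-! ### The section at the bottom -/

theorem f_letter_zero (b : Bool) : S.f (letter b) 0 = 0 := by
  cases b
  · exact (S.f0_fixed 0 (by simp)).2 (.inl rfl)
  · exact (S.f2_fixed 0 (by simp)).2 (.inl rfl)

theorem isInvariantSection_zero : S.IsInvariantSection fun _ => 0 where
  measurable := measurable_const
  mem_Icc _ := by simp
  map_leftShift w := (S.f_letter_zero (w 0)).symm

theorem centralExponent_zero_pos : 0 < S.centralExponent S.isInvariantSection_zero.graphMeasure := by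
  rw [IsInvariantSection.centralExponent_graphMeasure]
  obtain ⟨m, hm, hmle⟩ : ∃ m > 0, ∀ b, m ≤ Real.log |unitDeriv (S.f (letter b)) 0| := by
    refine ⟨min (Real.log (unitDeriv (S.f 0) 0)) (Real.log (unitDeriv (S.f 2) 0)),
      lt_min (Real.log_pos S.f0_zero) (Real.log_pos S.f2_zero), fun b => ?_⟩
    rw [Real.log_abs]
    cases b
    · exact min_le_left _ _
    · exact min_le_right _ _
  have hint : Integrable (fun w : ℤ → Bool => Real.log |unitDeriv (S.f (letter (w 0))) 0|)
      coinFlips := by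
    obtain ⟨C, hC⟩ := S.exists_logCentral_bound
    exact .of_bound S.isInvariantSection_zero.measurable_log_unitDeriv.aestronglyMeasurable C
      (.of_forall fun w => hC _ _ (by simp))
  calc 0 < m := hm
    _ = ∫ _ : ℤ → Bool, m ∂coinFlips := by simp
    _ ≤ _ := integral_mono (integrable_const m) hint fun w => hmle (w 0)

theorem graphMeasure_zero_compl_Lam02 :
    S.isInvariantSection_zero.graphMeasure {X | (X : (ℝ × ℝ) × ℝ) ∉ S.Lam02} = 0 := by
  have h : ∀ w, (S.isInvariantSection_zero.graph w : (ℝ × ℝ) × ℝ) ∈ S.Lam02 := fun w => by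
    refine ⟨⟨S.ϖ.symm (lateralWord w), ?_, rfl⟩, rfl⟩
    rw [mem_preimage, S.ϖ.apply_symm_apply]
    exact fun n => letter_eq (w n)
  -- Inside `Lam` the lateral horseshoe is cut out by countably many conditions on coordinates and
  -- one on the fibre.
  have hm : MeasurableSet {X : S.Lam | (X : (ℝ × ℝ) × ℝ) ∈ S.Lam02} := by
    have heq : {X : S.Lam | (X : (ℝ × ℝ) × ℝ) ∈ S.Lam02} =
        (⋂ n : ℤ, (fun X => S.proj X n) ⁻¹' {0, 2}) ∩ (fun X : S.Lam => X.1.2) ⁻¹' {0} := by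
      ext X
      simp only [mem_ofPred_eq, mem_inter_iff, mem_iInter, mem_preimage]
      refine and_congr_left fun _ => ⟨?_, fun hX => ⟨⟨X.1.1, S.fst_mem_Gam X.2⟩, hX, rfl⟩⟩
      rintro ⟨y, hy, hyX⟩
      have : y = ⟨X.1.1, S.fst_mem_Gam X.2⟩ := Subtype.ext hyX
      rwa [this] at hy
    rw [heq]
    refine .inter (.iInter fun n => ?_)
      ((measurable_snd.comp measurable_subtype_coe) (measurableSet_singleton 0))
    exact ((measurable_pi_apply n).comp S.continuous_proj.measurable) (Set.toFinite _).measurableSet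
  exact (ae_map_iff S.isInvariantSection_zero.measurable_graph.aemeasurable hm).2 (.of_forall h)

/-! ### The section at the top -/

theorem strictMonoOn_f_letter (b : Bool) : StrictMonoOn (S.f (letter b)) (Icc 0 1) := by
  cases b
  · exact S.f0_mono
  · exact S.f2_mono

theorem measurable_f_letter {c : (ℤ → Bool) → Bool} (hc : Measurable c) {ψ : (ℤ → Bool) → ℝ}
    (hψ : Measurable ψ) (hψI : ∀ w, ψ w ∈ Icc (0 : ℝ) 1) :
    Measurable fun w => S.f (letter (c w)) (ψ w) := by
  have h1 : ∀ b, Measurable fun w => S.f (letter b) (ψ w) := fun b =>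
    (S.contDiffOn_f (letter b)).continuousOn.domRestrict.measurable.comp (hψ.subtype_mk (h := hψI))
  exact (measurable_from_prod_countable_right (f := fun q : Bool × (ℤ → Bool) =>
    S.f (letter q.1) (ψ q.2)) h1).comp (hc.prodMk measurable_id)

/-- The images of `1` under the fibre maps along the past of a sequence. -/
def upperApprox : ℕ → (ℤ → Bool) → ℝ
  | 0, _ => 1
  | n + 1, w => S.f (letter (w (-1))) (upperApprox n (rightShift w))

theorem upperApprox_succ_leftShift (n : ℕ) (w : ℤ → Bool) :
    S.upperApprox (n + 1) (leftShift w) = S.f (letter (w 0)) (S.upperApprox n w) := by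
  simp [upperApprox, rightShift_leftShift]

theorem upperApprox_mem_Icc (n : ℕ) (w : ℤ → Bool) : S.upperApprox n w ∈ Icc (0 : ℝ) 1 := by
  induction n generalizing w with
  | zero => simp [upperApprox]
  | succ n ih => exact S.mapsTo_f _ (ih _)

theorem measurable_upperApprox (n : ℕ) : Measurable (S.upperApprox n) := by
  induction n with
  | zero => exact measurable_const
  | succ n ih =>
    exact S.measurable_f_letter (measurable_pi_apply (-1))
      (ih.comp measurePreserving_rightShift.measurable) fun _ => S.upperApprox_mem_Icc _ _

/-- The first step descends from the maximal value $1$, and increasing fibre maps preserve the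
inequality. -/
theorem antitone_upperApprox (w : ℤ → Bool) : Antitone fun n => S.upperApprox n w := by
  refine antitone_nat_of_succ_le fun n => ?_
  induction n generalizing w with
  | zero => exact (S.upperApprox_mem_Icc 1 w).2
  | succ n ih =>
    exact (S.strictMonoOn_f_letter _).monotoneOn (S.upperApprox_mem_Icc _ _)
      (S.upperApprox_mem_Icc _ _) (ih _)

theorem bddBelow_range_upperApprox (w : ℤ → Bool) : BddBelow (range fun n => S.upperApprox n w) :=
  ⟨0, by rintro _ ⟨n, rfl⟩; exact (S.upperApprox_mem_Icc n w).1⟩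

/-- The upper boundary of `Lam` over the sequences in `{0,2}^ℤ`. -/
def upper (w : ℤ → Bool) : ℝ := ⨅ n, S.upperApprox n w

theorem tendsto_upperApprox (w : ℤ → Bool) :
    Tendsto (fun n => S.upperApprox n w) atTop (𝓝 (S.upper w)) :=
  tendsto_atTop_ciInf (S.antitone_upperApprox w) (S.bddBelow_range_upperApprox w)

theorem upper_mem_Icc (w : ℤ → Bool) : S.upper w ∈ Icc (0 : ℝ) 1 :=
  isClosed_Icc.mem_of_tendsto (S.tendsto_upperApprox w)
    (.of_forall fun n => S.upperApprox_mem_Icc n w)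

theorem upper_leftShift (w : ℤ → Bool) :
    S.upper (leftShift w) = S.f (letter (w 0)) (S.upper w) := by
  refine tendsto_nhds_unique ((S.tendsto_upperApprox (leftShift w)).comp (tendsto_add_atTop_nat 1))
    ?_
  have h := ((S.contDiffOn_f (letter (w 0))).continuousOn _ (S.upper_mem_Icc w)).tendsto.comp
    (tendsto_nhdsWithin_iff.2 ⟨S.tendsto_upperApprox w,
      .of_forall fun n => S.upperApprox_mem_Icc n w⟩)
  refine h.congr fun n => ?_
  simp only [Function.comp_apply, upperApprox_succ_leftShift]

theorem isInvariantSection_upper : S.IsInvariantSection S.upper where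
  measurable := .iInf S.measurable_upperApprox
  mem_Icc := S.upper_mem_Icc
  map_leftShift := S.upper_leftShift

/-- If $f_2$ reached $1$ anywhere it would fix $1$ by monotonicity, but its fixed points are $0$ and
$p_2<1$. -/
theorem f_letter_eq_one {b : Bool} {x : ℝ} (hx : x ∈ Icc (0 : ℝ) 1) (h : S.f (letter b) x = 1) :
    b = false ∧ x = 1 := by
  have h1 : (1 : ℝ) ∈ Icc (0 : ℝ) 1 := by simp
  cases b
  · refine ⟨rfl, S.injOn_f 0 hx h1 ?_⟩
    rw [(S.f0_fixed 1 h1).2 (.inr rfl)]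
    exact h
  · exfalso
    have h2 : S.f 2 x ≤ S.f 2 1 := S.f2_mono.monotoneOn hx h1 hx.2
    have h3 : S.f 2 1 = 1 := le_antisymm (S.mapsTo_f 2 h1).2 (h.symm.le.trans h2)
    rcases (S.f2_fixed 1 h1).1 h3 with h | h
    · exact one_ne_zero h
    · exact S.p₂_mem.2.ne h.symm

theorem coinFlips_coord (b : Bool) : coinFlips.real {w | w 0 = b} = 2⁻¹ := by
  have h := Measure.infinitePi_map_eval (fun _ : ℤ => coin) 0
  have h2 : coin.real {b} = coinFlips.real ((fun w : ℤ → Bool => w 0) ⁻¹' {b}) := by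
    rw [← h, map_measureReal_apply (measurable_pi_apply 0) (measurableSet_singleton b)]
    rfl
  rw [coin_real_singleton] at h2
  rw [Fintype.card_bool] at h2
  exact h2.symm

/-- The set where the boundary equals $1$ contains its own preimage, so ergodicity makes it null or
full. Its preimage forces the letter $0$ at time $0$, an event of probability $\tfrac12$, so it is
not full. -/
theorem ae_upper_lt_one : ∀ᵐ w ∂coinFlips, S.upper w < 1 := by
  set B : Set (ℤ → Bool) := {w | S.upper w = 1}
  have hBm : MeasurableSet B :=
    S.isInvariantSection_upper.measurable (measurableSet_singleton 1)
  have hB : ∀ w, leftShift w ∈ B → w 0 = false ∧ w ∈ B := fun w hw =>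
    S.f_letter_eq_one (S.upper_mem_Icc w) ((S.upper_leftShift w).symm.trans hw)
  rcases ergodic_coinFlips.ae_empty_or_univ_of_preimage_ae_le hBm.nullMeasurableSet
    (.of_forall fun w hw => (hB w hw).2) with h | h
  · filter_upwards [measure_eq_zero_iff_ae_notMem.1 (ae_eq_empty.1 h)] with w hw
    exact (S.upper_mem_Icc w).2.lt_of_ne hw
  · exfalso
    have h1 : coinFlips.real (leftShift ⁻¹' B) = 1 := by
      rw [ergodic_coinFlips.toMeasurePreserving.measureReal_preimage hBm.nullMeasurableSet,
        measureReal_congr h]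
      simp
    have h2 : coinFlips.real (leftShift ⁻¹' B) ≤ 2⁻¹ := by
      rw [← coinFlips_coord false]
      exact measureReal_mono fun w hw => (hB w hw).1
    norm_num [h1] at h2

/-- Strictly increasing fibre maps carry the strict gap below $1$ forward from the past. The gap
must be positive for its logarithm to be meaningful. -/
theorem ae_upper_lt_upperApprox (n : ℕ) : ∀ᵐ w ∂coinFlips, S.upper w < S.upperApprox n w := by
  induction n with
  | zero => exact S.ae_upper_lt_one
  | succ n ih =>
    filter_upwards [measurePreserving_rightShift.quasiMeasurePreserving.ae ih] with w hw
    have h := S.strictMonoOn_f_letter (rightShift w 0) (S.upper_mem_Icc _)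
      (S.upperApprox_mem_Icc _ _) hw
    rwa [← upper_leftShift, ← upperApprox_succ_leftShift, leftShift_rightShift] at h

theorem exists_unitDeriv_eq_slope (i : Fin 3) {x y : ℝ} (hx : x ∈ Icc (0 : ℝ) 1)
    (hy : y ∈ Icc (0 : ℝ) 1) (hxy : x < y) :
    ∃ z ∈ Icc (0 : ℝ) 1, unitDeriv (S.f i) z = slope (S.f i) x y := by
  have hsub : Ioo x y ⊆ Ioo 0 1 := Ioo_subset_Ioo hx.1 hy.2
  have hdiff := (S.contDiffOn_f i).differentiableOn one_ne_zero
  obtain ⟨z, hz, h⟩ := exists_deriv_eq_slope (S.f i) hxy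
    ((S.contDiffOn_f i).continuousOn.mono (Icc_subset_Icc hx.1 hy.2))
    ((hdiff.mono Ioo_subset_Icc_self).mono hsub)
  refine ⟨z, Ioo_subset_Icc_self (hsub hz), ?_⟩
  rw [slope_def_field, ← h, unitDeriv,
    derivWithin_of_mem_nhds (Icc_mem_nhds (hsub hz).1 (hsub hz).2)]

theorem centralExponent_upper_nonpos :
    S.centralExponent S.isInvariantSection_upper.graphMeasure ≤ 0 := by
  rw [IsInvariantSection.centralExponent_graphMeasure]
  obtain ⟨C, hC⟩ := S.exists_logCentral_bound
  let h : ℕ → (ℤ → Bool) → ℝ := fun n w => Real.log (S.upperApprox n w - S.upper w)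
  -- Almost everywhere this is the logarithm of the slope of the fibre map between `upper` and
  -- `upperApprox n`.
  let s : ℕ → (ℤ → Bool) → ℝ := fun n w => h (n + 1) (leftShift w) - h n w
  have hm : ∀ n, Measurable (h n) := fun n =>
    Real.measurable_log.comp ((S.measurable_upperApprox n).sub S.isInvariantSection_upper.measurable)
  have hsm : ∀ n, Measurable (s n) := fun n => ((hm _).comp measurable_leftShift).sub (hm n)
  have hnonpos : ∀ n w, h n w ≤ 0 := fun n w => by
    have h1 := ciInf_le (S.bddBelow_range_upperApprox w) n
    refine Real.log_nonpos (sub_nonneg.2 h1) ?_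
    linarith [(S.upperApprox_mem_Icc n w).2, (S.upper_mem_Icc w).1]
  have hslope : ∀ n, ∀ w, S.upper w < S.upperApprox n w →
      s n w = Real.log |slope (S.f (letter (w 0))) (S.upper w) (S.upperApprox n w)| := by
    intro n w hw
    have h1 := S.strictMonoOn_f_letter (w 0) (S.upper_mem_Icc _) (S.upperApprox_mem_Icc _ _) hw
    simp only [s, h, upper_leftShift, upperApprox_succ_leftShift]
    rw [Real.log_abs, slope_def_field, Real.log_div (sub_pos.2 h1).ne' (sub_pos.2 hw).ne']
  have hbound : ∀ n, ∀ᵐ w ∂coinFlips, ‖s n w‖ ≤ C := fun n => by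
    filter_upwards [S.ae_upper_lt_upperApprox n] with w hw
    obtain ⟨z, hz, hzs⟩ := S.exists_unitDeriv_eq_slope (letter (w 0)) (S.upper_mem_Icc w)
      (S.upperApprox_mem_Icc n w) hw
    rw [hslope n w hw, ← hzs]
    exact hC _ z hz
  have hle : ∀ n, ∫ w, s n w ∂coinFlips ≤ 0 := fun n => by
    refine integral_nonpos_of_le_coboundary ergodic_coinFlips.toMeasurePreserving (hm n)
      (hnonpos n) (.of_bound (hsm n).aestronglyMeasurable C (hbound n)) ?_
    filter_upwards [ergodic_coinFlips.quasiMeasurePreserving.ae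
      (S.ae_upper_lt_upperApprox (n + 1))] with w hw
    -- Replacing the index $n+1$ by $n$ enlarges the gap and leaves a true coboundary of `h n`.
    refine sub_le_sub_right (Real.log_le_log (sub_pos.2 hw) (sub_le_sub_right ?_ _)) _
    exact S.antitone_upperApprox _ n.le_succ
  refine le_of_tendsto' (tendsto_integral_of_dominated_convergence (fun _ => C)
    (fun n => (hsm n).aestronglyMeasurable) (integrable_const C) hbound ?_) hle
  filter_upwards [ae_all_iff.2 S.ae_upper_lt_upperApprox] with w hw
  have hder : HasDerivWithinAt (S.f (letter (w 0))) (unitDeriv (S.f (letter (w 0))) (S.upper w))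
      (Icc 0 1) (S.upper w) :=
    ((S.contDiffOn_f _).differentiableOn one_ne_zero _ (S.upper_mem_Icc w)).hasDerivWithinAt
  -- The approximations converge to `upper` without touching it, so the slopes converge to the
  -- derivative there.
  have hlim := (hasDerivWithinAt_iff_tendsto_slope.1 hder).comp
    (tendsto_nhdsWithin_iff.2 ⟨S.tendsto_upperApprox w,
      .of_forall fun n => ⟨S.upperApprox_mem_Icc n w, (hw n).ne'⟩⟩)
  refine (hlim.abs.log (abs_ne_zero.2
    (S.unitDeriv_f_ne_zero _ _ (S.upper_mem_Icc w)))).congr fun n => ?_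
  exact (hslope n w (hw n)).symm

end SkewProduct

end HorseshoeSkew

end

theorem mainTheorem8 (S : HorseshoeSkew.SkewProduct) :
    ∃ μ₁ μ₂ : Measure S.Lam,
      IsProbabilityMeasure μ₁ ∧ IsProbabilityMeasure μ₂ ∧
      Ergodic S.FLam μ₁ ∧ Ergodic S.FLam μ₂ ∧
      HorseshoeSkew.metricEntropy μ₁ S.FLam = ((Real.log 2 : ℝ) : EReal) ∧
      HorseshoeSkew.metricEntropy μ₂ S.FLam = ((Real.log 2 : ℝ) : EReal) ∧
      Integrable S.logCentral μ₁ ∧ Integrable S.logCentral μ₂ ∧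
      S.centralExponent μ₁ ≤ 0 ∧ 0 < S.centralExponent μ₂ ∧
      Measure.map S.proj μ₁ =
        HorseshoeSkew.bernoulliMeasure HorseshoeSkew.halfZeroHalf ∧
      Measure.map S.proj μ₂ =
        HorseshoeSkew.bernoulliMeasure HorseshoeSkew.halfZeroHalf ∧
      μ₂ {X | (X : (ℝ × ℝ) × ℝ) ∉ S.Lam02} = 0 :=
  have h₁ := S.isInvariantSection_upper
  have h₂ := S.isInvariantSection_zero
  ⟨h₁.graphMeasure, h₂.graphMeasure, inferInstance, inferInstance, h₁.ergodic_graphMeasure,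
    h₂.ergodic_graphMeasure, h₁.metricEntropy_graphMeasure, h₂.metricEntropy_graphMeasure,
    HorseshoeSkew.SkewProduct.integrable_logCentral _,
    HorseshoeSkew.SkewProduct.integrable_logCentral _,
    S.centralExponent_upper_nonpos, S.centralExponent_zero_pos, h₁.map_proj_graphMeasure,
    h₂.map_proj_graphMeasure, S.graphMeasure_zero_compl_Lam02⟩
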